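/- Let $V$ nodes be divided into $d$ layers, layer $k$ having $V_k$ nodes, and let $\theta,\theta_0>0$. Let $\mathbf z\sim\mathrm{pExP}(\mathbf V;\theta,\theta_0)$ be the random node partition induced by a hierarchical Dirichlet process with concentration parameters $\theta,\theta_0$, generated as follows. Independently over the layers $k$, draw $\tilde Q_k\sim\mathrm{DP}(\theta,G_k)$ with $G_k$ diffuse and, given $\tilde Q_k$, draw i.i.d. variables $t_u\sim\tilde Q_k$ for the nodes $u$ of layer $k$; the subgroups of layer $k$ are the classes of its nodes with equal $t_u$, and $\mathbf w$ records the subgroup of each node, labelled in order of appearance within its layer. Independently of all this, draw $\tilde P_0\sim\mathrm{DP}(\theta_0,P_0)$ with $P_0$ diffuse and, given $\tilde P_0$, assign to the subgroups of all layers i.i.d. sociability profiles from $\tilde P_0$; then $\mathbf z$ records the profile of (the subgroup of) each node, profiles being labelled in order of appearance. Let $v$ be a node in layer $j$. Let $\mathbf z^{-v},\mathbf w^{-v}$ be the vectors obtained from $\mathbf z,\mathbf w$ by removing $v$ and relabelling in order of appearance; $z_v$ is labelled accordingly, an extra label standing for a profile that no other node has. Let $\mathbf H^{-v}$ and $\mathbf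 H_j^{-v}$ be the sets of profiles shown by the nodes other than $v$ in the whole network and in layer $j$, respectively, and let $|\boldsymbol\ell^{-v}|$ be the total number of subgroups, over all layers, formed by the nodes other than $v$. Then, for every value of $(\mathbf z^{-v},\mathbf w^{-v})$ of positive probability, $$\theta\le (V_j-1)\left(\frac{\theta_0}{|\boldsymbol\ell^{-v}|}+1\right)\ \Longrightarrow\ \mathbb P(z_v\in\mathbf H_j^{-v}\mid\mathbf z^{-v},\mathbf w^{-v})\ \ge\ \mathbb P(z_v\in\mathbf H^{-v}\setminus\mathbf H_j^{-v}\mid\mathbf z^{-v},\mathbf w^{-v}),$$ and $$\theta\le V_j-1\ \Longrightarrow\ \mathbb P(z_v\in\mathbf H_j^{-v}\mid\mathbf z^{-v},\mathbf w^{-v})\ \ge\ \mathbb P(z_v\notin\mathbf H_j^{-v}\mid\mathbf z^{-v},\mathbf w^{-v}).$$ (If $V=1$, then $|\boldsymbol\ell^{-v}|=0$ and the right-hand side of the first condition is read as $0$.) -/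

import Mathlib

open MeasureTheory ProbabilityTheory

namespace PExP

/-! ### Dirichlet processes and sampling from a random probability measure -/

/-- The gamma law with shape `a` and rate `1`, where shape `0` is read as the point mass at `0`. -/
noncomputable def gammaLaw (a : ℝ) : Measure ℝ :=
  if 0 < a then gammaMeasure a 1 else Measure.dirac 0

/-- The Dirichlet law with parameters `α i ≥ 0` (not all zero): the law of independent
`Gamma(α i, 1)` variables divided by their sum. -/
noncomputable def dirichletLaw {k : ℕ} (α : Fin k → ℝ) : Measure (Fin k → ℝ) :=
  (Measure.pi fun i => gammaLaw (α i)).map fun g i => g i / ∑ l, g l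

/-- `Q` is a Dirichlet process `DP(θ, G)`: a random probability measure whose values on every
finite measurable partition `A` have the Dirichlet law with parameters `θ * G (A i)`. -/
structure IsDirichletProcess {Ω X : Type*} [MeasurableSpace Ω] [MeasurableSpace X]
    (P : Measure Ω) (Q : Ω → Measure X) (θ : ℝ) (G : Measure X) : Prop where
  measurable : Measurable Q
  isProbabilityMeasure : ∀ ω, IsProbabilityMeasure (Q ω)
  map_partition : ∀ (k : ℕ) (A : Fin k → Set X), (∀ i, MeasurableSet (A i)) →
    Pairwise (fun i l => Disjoint (A i) (A l)) → (⋃ i, A i) = Set.univ →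
    P.map (fun ω i => (Q ω).real (A i)) = dirichletLaw fun i => θ * G.real (A i)

/-- Given the random probability measure `Q`, the variables `x i` are i.i.d. with law `Q`. -/
def IsCondIID {Ω X ι : Type*} [MeasurableSpace Ω] [MeasurableSpace X]
    (P : Measure Ω) (Q : Ω → Measure X) (x : ι → Ω → X) : Prop :=
  (∀ i, Measurable (x i)) ∧
  ∀ (B : Set (Measure X)), MeasurableSet B →
  ∀ (S : Finset ι) (A : ι → Set X), (∀ i, MeasurableSet (A i)) →
    P {ω | Q ω ∈ B ∧ ∀ i ∈ S, x i ω ∈ A i} = ∫⁻ ω in Q ⁻¹' B, ∏ i ∈ S, Q ω (A i) ∂P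

/-! ### Labels in order of appearance -/

/-- The label, in `{1, …, H + 1}`, of the value `y` relative to the family `x`, whose `H` distinct
values are labelled `1, …, H` in order of appearance: one plus the number of distinct values of `x`
that appear before `y` does. A value that does not occur in `x` gets the label `H + 1`. -/
noncomputable def orderLabel {ι α : Type*} [LinearOrder ι] (x : ι → α) (y : α) : ℕ :=
  {a : ι | (∀ b < a, x b ≠ x a) ∧ ∀ b ≤ a, x b ≠ y}.ncard + 1

/-! ### The generative scheme

The nodes are `Fin n`, and `layer u` is the layer of the node `u`. -/

/-- The auxiliary variables behind the partition induced by a hierarchical Dirichlet process with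
concentration parameters `θ` and `θ₀`. In each layer `j`, the nodes receive variables `t u` that are
i.i.d. from `Q j ~ DP(θ, G j)`, and the possible subgroups `τ` of the layer receive sociability
profiles `s j τ` that are i.i.d. from one `R ~ DP(θ₀, P₀)`. The layers are independent in the first
step, and the second step is independent of the first. -/
structure IsHDPScheme {Ω T X : Type*} [MeasurableSpace Ω] [MeasurableSpace T] [MeasurableSpace X]
    (P : Measure Ω) {n d : ℕ} (layer : Fin n → Fin d) (θ θ₀ : ℝ)
    (G : Fin d → Measure T) (P₀ : Measure X)
    (Q : Fin d → Ω → Measure T) (t : Fin n → Ω → T)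
    (R : Ω → Measure X) (s : Fin d → ℕ → Ω → X) : Prop where
  dirichlet_layer : ∀ j, IsDirichletProcess P (Q j) θ (G j)
  sample_layer : ∀ j, IsCondIID P (Q j) fun u : {u : Fin n // layer u = j} => t u
  indep_layers : iIndepFun (fun j ω => (Q j ω, fun u : {u : Fin n // layer u = j} => t u ω)) P
  dirichlet_root : IsDirichletProcess P R θ₀ P₀
  sample_root : IsCondIID P R fun p : Fin d × ℕ => s p.1 p.2
  indep_root : IndepFun (fun ω => ((fun j => Q j ω), fun u => t u ω))
    (fun ω => (R ω, fun j τ => s j τ ω)) P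

/-- Subgroup allocations `w`: in each layer, the subgroups are the classes of nodes with equal `t`,
labelled `1, 2, …` in order of appearance in that layer. -/
noncomputable def subgroupAlloc {T : Type*} {n d : ℕ} (layer : Fin n → Fin d) (t : Fin n → T)
    (u : Fin n) : ℕ :=
  orderLabel (fun u' : {u' : Fin n // layer u' = layer u} => t u') (t u)

/-- The attribute of a node is the sociability profile of its subgroup. -/
noncomputable def nodeAttr {T X : Type*} {n d : ℕ} (layer : Fin n → Fin d) (t : Fin n → T)
    (s : Fin d → ℕ → X) (u : Fin n) : X :=
  s (layer u) (subgroupAlloc layer t u)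

/-- Group allocations `z`: the groups are the classes of nodes with equal attribute, labelled
`1, 2, …` in order of appearance. -/
noncomputable def groupAlloc {T X : Type*} {n d : ℕ} (layer : Fin n → Fin d) (t : Fin n → T)
    (s : Fin d → ℕ → X) (u : Fin n) : ℕ :=
  orderLabel (nodeAttr layer t s) (nodeAttr layer t s u)

/-! ### Removing a node -/

/-- `relabelGroup z v u` is the group label of `u` once the groups are relabelled in order of
appearance with node `v` removed. For `u ≠ v` these labels form the vector `z⁻ᵛ`; for `u = v` this
is `z_v ∈ {1, …, H⁻ᵛ + 1}`, with `H⁻ᵛ + 1` standing for a group that contains no other node. -/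
noncomputable def relabelGroup {n : ℕ} (z : Fin n → ℕ) (v u : Fin n) : ℕ :=
  orderLabel (fun u' : {u' : Fin n // u' ≠ v} => z u') (z u)

/-- The vector `z⁻ᵛ`. -/
noncomputable def removeGroup {n : ℕ} (z : Fin n → ℕ) (v : Fin n) (u : {u : Fin n // u ≠ v}) : ℕ :=
  relabelGroup z v u

/-- The vector `w⁻ᵛ`: subgroups are relabelled in each layer in order of appearance, with node `v`
removed. -/
noncomputable def removeSubgroup {n d : ℕ} (layer : Fin n → Fin d) (w : Fin n → ℕ) (v : Fin n)
    (u : {u : Fin n // u ≠ v}) : ℕ :=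
  orderLabel (fun u' : {u' : Fin n // u' ≠ v ∧ layer u' = layer u} => w u') (w u)

/-- `V_j`, the number of nodes in layer `j`. -/
def layerSize {n d : ℕ} (layer : Fin n → Fin d) (j : Fin d) : ℕ :=
  (Finset.univ.filter fun u => layer u = j).card

/-- `|ℓ⁻ᵛ|`, the total number of subgroups in all layers, as a function of `w⁻ᵛ`. -/
noncomputable def numSubgroups {n d : ℕ} (layer : Fin n → Fin d) {v : Fin n}
    (wv : {u : Fin n // u ≠ v} → ℕ) : ℕ :=
  (Set.range fun u : {u : Fin n // u ≠ v} => (layer u, wv u)).ncard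

/-- `H⁻ᵛ`, the set of profiles observed in the network without `v`, as a function of `z⁻ᵛ`. -/
def profiles {n : ℕ} {v : Fin n} (zv : {u : Fin n // u ≠ v} → ℕ) : Set ℕ :=
  Set.range zv

/-- `H_j⁻ᵛ`, the set of profiles observed in layer `j` without `v`, as a function of `z⁻ᵛ`. -/
def layerProfiles {n d : ℕ} (layer : Fin n → Fin d) (j : Fin d) {v : Fin n}
    (zv : {u : Fin n // u ≠ v} → ℕ) : Set ℕ :=
  zv '' {u | layer u = j}

end PExP

open scoped ENNReal

namespace PExP

/-! ### Moments of the Dirichlet law -/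

/-! Put `m = V_j - 1` and `l = |ℓ⁻ᵛ|`. By exchangeability `v` may be treated as the last node of its
layer. Given `(z⁻ᵛ, w⁻ᵛ)`, it joins one of the subgroups formed by the other nodes of its layer with
probability `m / (θ + m)`, and its profile then lies in `H_j⁻ᵛ`. Otherwise it founds a subgroup,
whose profile repeats one of the `l` earlier draws with probability `l / (θ₀ + l)`. Hence,
conditionally, `P(H_j⁻ᵛ) ≥ m / (θ + m)`, `P(H⁻ᵛ \ H_j⁻ᵛ) ≤ θ / (θ + m) * (l / (θ₀ + l))`, and `P(not
H_j⁻ᵛ) ≤ θ / (θ + m)`. The first condition says `θ * l / (θ₀ + l) ≤ m` when `l > 0`, the second `θ ≤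
m`. A founded subgroup may still draw a profile of `H_j⁻ᵛ`; this only helps and is ignored.

Both repetition probabilities come from the urn scheme (`IsDirichletProcess.map_pair`,
`IsDirichletProcess.measure_repeat`), which rests on the ratio of consecutive Dirichlet moments
(`dirichletMoment_add_single`). Conditioning on `z⁻ᵛ` as well as `w⁻ᵛ` is harmless: for fixed `t`,
exchangeability of the profiles makes the probability of `z⁻ᵛ` a function of `w⁻ᵛ` alone
(`IsHDPScheme.measure_removeGroup`), and `IsHDPScheme.measure_alloc` integrates the profiles out. -/

lemma lintegral_rpow_mul_exp {a r : ℝ} (ha : 0 < a) (hr : 0 < r) :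
    ∫⁻ x in Set.Ioi (0 : ℝ), ENNReal.ofReal (x ^ (a - 1) * Real.exp (-(r * x))) =
      ENNReal.ofReal (Real.Gamma a / r ^ a) := by
  have hG := Real.Gamma_pos_of_pos ha
  have hra := Real.rpow_pos_of_pos hr a
  have h : ∫⁻ x in Set.Ioi (0 : ℝ), gammaPDF a r x = 1 := by
    have h1 := lintegral_add_compl (μ := volume) (gammaPDF a r) (measurableSet_Ici (a := (0 : ℝ)))
    rwa [Set.compl_Ici, lintegral_gammaPDF_of_nonpos le_rfl, add_zero,
      lintegral_gammaPDF_eq_one ha hr, ← setLIntegral_congr Ioi_ae_eq_Ici] at h1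
  calc _ = ∫⁻ x in Set.Ioi (0 : ℝ), ENNReal.ofReal (Real.Gamma a / r ^ a) * gammaPDF a r x := by
        refine setLIntegral_congr_fun measurableSet_Ioi fun x hx => ?_
        rw [gammaPDF_of_nonneg (le_of_lt hx), ← ENNReal.ofReal_mul (by positivity)]
        congr 1
        field_simp
    _ = _ := by
        rw [lintegral_const_mul' _ _ ENNReal.ofReal_ne_top, h, mul_one]

lemma Gamma_add_nat {a : ℝ} (ha : 0 < a) (n : ℕ) :
    Real.Gamma (a + n) = (ascPochhammer ℝ n).eval a * Real.Gamma a := by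
  induction n with
  | zero => simp
  | succ n ih =>
    rw [ascPochhammer_succ_eval, Nat.cast_succ, ← add_assoc, Real.Gamma_add_one (by positivity), ih]
    ring

instance (a : ℝ) : IsProbabilityMeasure (gammaLaw a) := by
  unfold gammaLaw
  split_ifs with h
  · exact isProbabilityMeasure_gammaMeasure h one_pos
  · infer_instance

lemma ae_gammaMeasure_pos (a : ℝ) : ∀ᵐ x ∂gammaMeasure a 1, 0 < x := by
  have h0 : gammaMeasure a 1 (Set.Iic 0) = 0 := by
    rw [gammaMeasure, withDensity_apply _ measurableSet_Iic, ← setLIntegral_congr Iio_ae_eq_Iic,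
      lintegral_gammaPDF_of_nonpos le_rfl]
  rw [ae_iff]
  convert h0 using 2
  ext x; simp

lemma ae_gammaLaw_nonneg (a : ℝ) : ∀ᵐ x ∂gammaLaw a, 0 ≤ x := by
  unfold gammaLaw
  split_ifs with h
  · exact (ae_gammaMeasure_pos a).mono fun x hx => hx.le
  · simp [ae_dirac_eq]

lemma ae_gammaLaw_pos {a : ℝ} (ha : 0 < a) : ∀ᵐ x ∂gammaLaw a, 0 < x := by
  simpa [gammaLaw, ha] using ae_gammaMeasure_pos a

/-- Exponentially tilted moments of the gamma law. -/
lemma lintegral_gammaLaw {a : ℝ} (ha : 0 ≤ a) (n : ℕ) {c : ℝ} (hc : 0 ≤ c) :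
    ∫⁻ x, ENNReal.ofReal (x ^ n * Real.exp (-(c * x))) ∂gammaLaw a =
      ENNReal.ofReal ((ascPochhammer ℝ n).eval a) * ENNReal.ofReal ((1 + c) ^ (-(a + n))) := by
  rcases ha.eq_or_lt with rfl | ha
  · simp only [gammaLaw, lt_irrefl, if_false, lintegral_dirac]
    -- Shape `0`: both sides are `1` for `n = 0`; otherwise both vanish, the rising factorial having
    -- the factor `0`.
    rcases n with _ | n <;> simp
  · have hG := Real.Gamma_pos_of_pos ha
    have hn : (0 : ℝ) ≤ (ascPochhammer ℝ n).eval a := (ascPochhammer_pos n a ha).le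
    simp only [gammaLaw, ha, if_true, gammaMeasure]
    rw [lintegral_withDensity_eq_lintegral_mul _ (by unfold gammaPDF; fun_prop) (by fun_prop),
      ← lintegral_add_compl _ measurableSet_Iic, Set.compl_Iic]
    have h0 : ∫⁻ x in Set.Iic (0 : ℝ), (gammaPDF a 1 * fun x =>
        ENNReal.ofReal (x ^ n * Real.exp (-(c * x)))) x = 0 := by
      rw [← setLIntegral_congr Iio_ae_eq_Iic]
      rw [setLIntegral_congr_fun (g := fun _ => 0) measurableSet_Iio fun x hx => by
        simp [gammaPDF_of_neg (Set.mem_Iio.mp hx)]]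
      simp
    rw [h0, zero_add]
    calc _ = ∫⁻ x in Set.Ioi (0 : ℝ), ENNReal.ofReal (1 / Real.Gamma a) *
          ENNReal.ofReal (x ^ ((a + n) - 1) * Real.exp (-((1 + c) * x))) := by
          refine setLIntegral_congr_fun measurableSet_Ioi fun x hx => ?_
          have hx' : (0 : ℝ) < x := hx
          simp only [Pi.mul_apply]
          rw [gammaPDF_of_nonneg hx'.le, ← ENNReal.ofReal_mul (by positivity),
            ← ENNReal.ofReal_mul (by positivity)]
          congr 1
          have e1 : x ^ ((a + n) - 1) = x ^ (a - 1) * x ^ n := by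
            rw [← Real.rpow_natCast, ← Real.rpow_add hx']; ring_nf
          have e2 : Real.exp (-((1 + c) * x)) = Real.exp (-(1 * x)) * Real.exp (-(c * x)) := by
            rw [← Real.exp_add]; ring_nf
          rw [e1, e2, Real.one_rpow]
          ring
      _ = _ := by
          rw [lintegral_const_mul' _ _ ENNReal.ofReal_ne_top,
            lintegral_rpow_mul_exp (by positivity) (by positivity), ← ENNReal.ofReal_mul
              (by positivity), ← ENNReal.ofReal_mul hn, Gamma_add_nat ha,
            Real.rpow_neg (by positivity)]
          congr 1
          field_simp

lemma lintegral_pi_prod {ι : Type*} [Fintype ι] (μ : ι → Measure ℝ)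
    [∀ i, IsProbabilityMeasure (μ i)] (f : ι → ℝ → ℝ≥0∞) (hf : ∀ i, Measurable (f i)) :
    ∫⁻ x, ∏ i, f i (x i) ∂Measure.pi μ = ∏ i, ∫⁻ x, f i x ∂μ i := by
  have hind : iIndepFun (fun i (x : ι → ℝ) => f i (x i)) (Measure.pi μ) :=
    iIndepFun_pi (X := f) fun i => (hf i).aemeasurable
  rw [lintegral_prod_eq_prod_lintegral_of_indepFun Finset.univ _ hind fun i => by fun_prop]
  refine Finset.prod_congr rfl fun i _ => ?_
  exact (measurePreserving_eval μ i).lintegral_comp (hf i)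

lemma ae_sum_gamma_pos {k : ℕ} {α : Fin k → ℝ} (hpos : ∃ i, 0 < α i) :
    ∀ᵐ g ∂Measure.pi fun i => gammaLaw (α i), (∀ i, 0 ≤ g i) ∧ 0 < ∑ i, g i := by
  obtain ⟨b, hb⟩ := hpos
  have h1 : ∀ᵐ g ∂Measure.pi fun i => gammaLaw (α i), ∀ i, 0 ≤ g i :=
    ae_all_iff.mpr fun i => (Measure.quasiMeasurePreserving_eval
      (fun i => gammaLaw (α i)) i).ae (ae_gammaLaw_nonneg (α i))
  have h2 : ∀ᵐ g ∂Measure.pi fun i => gammaLaw (α i), 0 < g b :=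
    (Measure.quasiMeasurePreserving_eval
      (fun i => gammaLaw (α i)) b).ae (ae_gammaLaw_pos hb)
  filter_upwards [h1, h2] with g h1 h2
  exact ⟨h1, Finset.sum_pos' (fun i _ => h1 i) ⟨b, Finset.mem_univ _, h2⟩⟩

/-- The mixed moment of order `m` of the Dirichlet law. -/
noncomputable def dirichletMoment {k : ℕ} (α : Fin k → ℝ) (m : Fin k → ℕ) : ℝ≥0∞ :=
  ∫⁻ p, ∏ i, ENNReal.ofReal (p i) ^ m i ∂dirichletLaw α

lemma dirichletMoment_eq_pi {k : ℕ} (α : Fin k → ℝ) (m : Fin k → ℕ) :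
    dirichletMoment α m = ∫⁻ g, ∏ i, ENNReal.ofReal (g i / ∑ l, g l) ^ m i
      ∂Measure.pi fun i => gammaLaw (α i) := by
  rw [dirichletMoment, dirichletLaw, lintegral_map (by fun_prop) (by fun_prop)]

/-- With `S = ∑ g i` and `N = ∑ m i`, write `S ^ (-N) = Γ(N)⁻¹ ∫ c ^ (N - 1) exp (-c S) dc`. After
Tonelli the integrand splits into independent tilted gamma moments, whose powers of `1 + c` combine
to an exponent that sees `m` only through `N`. The value of `C` is never needed. -/
lemma exists_dirichletMoment_eq {k : ℕ} {α : Fin k → ℝ} (hα : ∀ i, 0 ≤ α i)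
    (hpos : ∃ i, 0 < α i) : ∃ C : ℕ → ℝ≥0∞, ∀ m : Fin k → ℕ, dirichletMoment α m =
      (∏ i, ENNReal.ofReal ((ascPochhammer ℝ (m i)).eval (α i))) * C (∑ i, m i) := by
  -- The integral representation requires `N > 0`, so degree `0` is set apart.
  refine ⟨fun N => if N = 0 then 1 else (ENNReal.ofReal (Real.Gamma N))⁻¹ *
    ∫⁻ c in Set.Ioi (0 : ℝ), ENNReal.ofReal (c ^ ((N : ℝ) - 1)) *
      ENNReal.ofReal ((1 + c) ^ (-(∑ i, α i + N))), fun m => ?_⟩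
  rw [dirichletMoment_eq_pi]
  set N := ∑ i, m i with hN
  by_cases h0 : N = 0
  · have hm : ∀ i, m i = 0 := by simpa [hN, Finset.sum_eq_zero_iff] using h0
    simp [h0, hm]
  have hNpos : (0 : ℝ) < N := by exact_mod_cast Nat.pos_of_ne_zero h0
  have hΓ := Real.Gamma_pos_of_pos hNpos
  simp only [if_neg h0]
  calc _ = ∫⁻ g, (∫⁻ c in Set.Ioi (0 : ℝ), (ENNReal.ofReal (Real.Gamma N))⁻¹ *
        (ENNReal.ofReal (c ^ ((N : ℝ) - 1)) *
          ∏ i, ENNReal.ofReal (g i ^ m i * Real.exp (-(c * g i)))))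
          ∂Measure.pi fun i => gammaLaw (α i) := by
        refine lintegral_congr_ae ?_
        filter_upwards [ae_sum_gamma_pos hpos] with g hg
        obtain ⟨hg, hS⟩ := hg
        have e : ∀ c ∈ Set.Ioi (0 : ℝ), (ENNReal.ofReal (Real.Gamma N))⁻¹ *
            (ENNReal.ofReal (c ^ ((N : ℝ) - 1)) *
              ∏ i, ENNReal.ofReal (g i ^ m i * Real.exp (-(c * g i)))) =
            ENNReal.ofReal ((Real.Gamma N)⁻¹ * ∏ i, g i ^ m i) *
              ENNReal.ofReal (c ^ ((N : ℝ) - 1) * Real.exp (-((∑ i, g i) * c))) := by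
          intro c hc
          have hc' : (0 : ℝ) < c := hc
          have hP : 0 ≤ ∏ i, g i ^ m i := Finset.prod_nonneg fun i _ => pow_nonneg (hg i) _
          rw [← ENNReal.ofReal_inv_of_pos hΓ, ← ENNReal.ofReal_prod_of_nonneg
            (fun i _ => mul_nonneg (pow_nonneg (hg i) _) (Real.exp_pos _).le),
            ← ENNReal.ofReal_mul (by positivity), ← ENNReal.ofReal_mul (by positivity),
            ← ENNReal.ofReal_mul (by positivity)]
          congr 1
          rw [Finset.prod_mul_distrib, ← Real.exp_sum, Finset.sum_neg_distrib, ← Finset.mul_sum,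
            mul_comm c]
          ring
        rw [setLIntegral_congr_fun measurableSet_Ioi e,
          lintegral_const_mul' _ _ ENNReal.ofReal_ne_top, lintegral_rpow_mul_exp hNpos hS,
          ← ENNReal.ofReal_mul (mul_nonneg (by positivity)
            (Finset.prod_nonneg fun i _ => pow_nonneg (hg i) _))]
        simp_rw [← ENNReal.ofReal_pow (div_nonneg (hg _) hS.le)]
        rw [← ENNReal.ofReal_prod_of_nonneg
          (fun i _ => pow_nonneg (div_nonneg (hg i) hS.le) _)]
        congr 1
        simp_rw [div_pow]
        rw [Finset.prod_div_distrib, Finset.prod_pow_eq_pow_sum, ← hN, Real.rpow_natCast]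
        field_simp
    _ = ∫⁻ c in Set.Ioi (0 : ℝ), (ENNReal.ofReal (Real.Gamma N))⁻¹ *
        (ENNReal.ofReal (c ^ ((N : ℝ) - 1)) * ∫⁻ g,
          ∏ i, ENNReal.ofReal (g i ^ m i * Real.exp (-(c * g i)))
          ∂Measure.pi fun i => gammaLaw (α i)) := by
        rw [lintegral_lintegral_swap]
        · refine lintegral_congr fun c => ?_
          rw [lintegral_const_mul _ (by fun_prop), lintegral_const_mul _ (by fun_prop)]
        · fun_prop
    _ = ∫⁻ c in Set.Ioi (0 : ℝ), ((ENNReal.ofReal (Real.Gamma N))⁻¹ *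
        ∏ i, ENNReal.ofReal ((ascPochhammer ℝ (m i)).eval (α i))) *
        (ENNReal.ofReal (c ^ ((N : ℝ) - 1)) *
          ENNReal.ofReal ((1 + c) ^ (-(∑ i, α i + N)))) := by
        refine setLIntegral_congr_fun measurableSet_Ioi fun c hc => ?_
        have hc' : (0 : ℝ) < c := hc
        rw [lintegral_pi_prod _ (fun i x => ENNReal.ofReal (x ^ m i * Real.exp (-(c * x))))
          (fun i => by fun_prop)]
        simp_rw [lintegral_gammaLaw (hα _) _ hc'.le]
        rw [Finset.prod_mul_distrib, ← ENNReal.ofReal_prod_of_nonneg (f := fun i =>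
          (1 + c) ^ (-(α i + m i))) (fun i _ => by positivity),
          ← Real.rpow_sum_of_pos (by positivity), Finset.sum_neg_distrib, Finset.sum_add_distrib,
          hN, Nat.cast_sum]
        ring
    _ = _ := by
        rw [lintegral_const_mul _ (by fun_prop)]
        ring

/-- Increasing one exponent of a mixed moment of the Dirichlet law. -/
lemma dirichletMoment_add_single {k : ℕ} {α : Fin k → ℝ} (hα : ∀ i, 0 ≤ α i)
    (hpos : ∃ i, 0 < α i) (m : Fin k → ℕ) (b : Fin k) :
    dirichletMoment α (m + Pi.single b 1) =
      ENNReal.ofReal ((α b + m b) / (∑ i, α i + ∑ i, (m i : ℝ))) * dirichletMoment α m := by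
  obtain ⟨C, hC⟩ := exists_dirichletMoment_eq hα hpos
  set D : ℝ≥0∞ := ∏ i, ENNReal.ofReal ((ascPochhammer ℝ (m i)).eval (α i)) with hD
  have hS : 0 < ∑ i, α i := by
    obtain ⟨i, hi⟩ := hpos
    exact Finset.sum_pos' (fun i _ => hα i) ⟨i, Finset.mem_univ _, hi⟩
  have hT : 0 < ∑ i, α i + ∑ i, (m i : ℝ) := by positivity
  have hstep : ∀ b, dirichletMoment α (m + Pi.single b 1) =
      ENNReal.ofReal (α b + m b) * (D * C (∑ i, m i + 1)) := by
    intro b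
    rw [hC, hD]
    have h1 : ∑ i, (m + Pi.single b 1 : Fin k → ℕ) i = ∑ i, m i + 1 := by
      simp [Finset.sum_add_distrib]
    have h2 : ∏ i, ENNReal.ofReal ((ascPochhammer ℝ ((m + Pi.single b 1 : Fin k → ℕ) i)).eval (α i)) =
        ENNReal.ofReal (α b + m b) *
          ∏ i, ENNReal.ofReal ((ascPochhammer ℝ (m i)).eval (α i)) := by
      rw [← Finset.mul_prod_erase _ _ (Finset.mem_univ b),
        ← Finset.mul_prod_erase Finset.univ (fun i => ENNReal.ofReal
          ((ascPochhammer ℝ (m i)).eval (α i))) (Finset.mem_univ b), ← mul_assoc,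
        ← ENNReal.ofReal_mul (add_nonneg (hα b) (Nat.cast_nonneg _))]
      congr 1
      · simp [ascPochhammer_succ_eval, mul_comm]
      · refine Finset.prod_congr rfl fun i hi => ?_
        simp [Finset.ne_of_mem_erase hi]
    rw [h1, h2, mul_assoc]
  -- The coordinates sum to `1`, so raising each exponent in turn and summing gives back the
  -- original moment. This fixes the ratio without evaluating `C`.
  have hsum : ∑ b, dirichletMoment α (m + Pi.single b 1) = dirichletMoment α m := by
    simp_rw [dirichletMoment_eq_pi]
    rw [← lintegral_finsetSum _ fun b _ => by fun_prop]
    refine lintegral_congr_ae ?_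
    filter_upwards [ae_sum_gamma_pos hpos] with g hg
    obtain ⟨hg, hS⟩ := hg
    have : ∀ b, ∏ i, ENNReal.ofReal (g i / ∑ l, g l) ^ (m + Pi.single b 1 : Fin k → ℕ) i =
        ENNReal.ofReal (g b / ∑ l, g l) * ∏ i, ENNReal.ofReal (g i / ∑ l, g l) ^ m i := by
      intro b
      simp_rw [Pi.add_apply, pow_add]
      rw [Finset.prod_mul_distrib, mul_comm]
      congr 1
      rw [Finset.prod_eq_single b (fun i _ hi => by simp [hi]) (by simp)]
      simp
    simp_rw [this]
    rw [← Finset.sum_mul, ← ENNReal.ofReal_sum_of_nonneg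
      (fun i _ => div_nonneg (hg i) hS.le), ← Finset.sum_div, div_self hS.ne']
    simp
  have hM : dirichletMoment α m =
      ENNReal.ofReal (∑ i, α i + ∑ i, (m i : ℝ)) * (D * C (∑ i, m i + 1)) := by
    rw [← hsum]
    simp_rw [hstep]
    rw [← Finset.sum_mul, ← ENNReal.ofReal_sum_of_nonneg
      (fun i _ => add_nonneg (hα i) (Nat.cast_nonneg _)), Finset.sum_add_distrib]
  rw [hstep, hM, ← mul_assoc (ENNReal.ofReal (_ / _)), ← ENNReal.ofReal_mul
    (div_nonneg (add_nonneg (hα b) (Nat.cast_nonneg _)) hT.le), div_mul_cancel₀ _ hT.ne']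

/-! ### The urn scheme of a Dirichlet process -/

lemma measure_pi_ext {κ X : Type*} [Finite κ] [MeasurableSpace X] {μ ν : Measure (κ → X)}
    [IsFiniteMeasure μ] (h : ∀ A : κ → Set X, (∀ k, MeasurableSet (A k)) →
      μ (Set.univ.pi A) = ν (Set.univ.pi A)) : μ = ν := by
  refine ext_of_generate_finite _ generateFrom_pi.symm isPiSystem_pi ?_ ?_
  · rintro _ ⟨A, hA, rfl⟩
    exact h A fun k => hA k (Set.mem_univ k)
  · simpa using h (fun _ => Set.univ) fun _ => MeasurableSet.univ

section CondIID

variable {Ω X ι κ : Type*} [MeasurableSpace Ω] [MeasurableSpace X]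
  {P : Measure Ω} {Q : Ω → Measure X} {x : ι → Ω → X}

lemma IsCondIID.measurable_family (hx : IsCondIID P Q x) (a : κ → ι) :
    Measurable fun ω k => x (a k) ω :=
  measurable_pi_iff.mpr fun k => hx.1 (a k)

variable [Fintype κ]

lemma IsCondIID.measure_cylinder (hx : IsCondIID P Q x) {a : κ → ι} (ha : a.Injective)
    {A : κ → Set X} (hA : ∀ k, MeasurableSet (A k)) :
    P {ω | ∀ k, x (a k) ω ∈ A k} = ∫⁻ ω, ∏ k, Q ω (A k) ∂P := by
  classical
  -- Indices outside the range of `a` get the whole space as constraint.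
  have h := hx.2 Set.univ MeasurableSet.univ (Finset.univ.map ⟨a, ha⟩)
    (Function.extend a A fun _ => Set.univ) (fun i => by
      by_cases hi : ∃ k, a k = i
      · obtain ⟨k, rfl⟩ := hi
        rw [ha.extend_apply]; exact hA k
      · rw [Function.extend_apply' _ _ _ hi]; exact MeasurableSet.univ)
  simpa [Finset.prod_map, ha.extend_apply] using h

/-- A conditionally i.i.d. family is exchangeable. -/
lemma IsCondIID.map_eq_map [IsFiniteMeasure P] (hx : IsCondIID P Q x) {a b : κ → ι}
    (ha : a.Injective) (hb : b.Injective) :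
    P.map (fun ω k => x (a k) ω) = P.map (fun ω k => x (b k) ω) := by
  refine measure_pi_ext fun A hA => ?_
  rw [Measure.map_apply (hx.measurable_family a) (MeasurableSet.univ_pi hA),
    Measure.map_apply (hx.measurable_family b) (MeasurableSet.univ_pi hA)]
  simpa [Set.preimage, Set.mem_pi] using
    (hx.measure_cylinder ha hA).trans (hx.measure_cylinder hb hA).symm

end CondIID

section Urn

variable {Ω X ι κ : Type*} [MeasurableSpace Ω] [MeasurableSpace X] [Fintype κ]
  {P : Measure Ω} {Q : Ω → Measure X} {θ : ℝ} {G : Measure X} {x : ι → Ω → X}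

/-- The fibres of `f` form a finite partition, so their masses have a Dirichlet law; grouping the
factors by the value of `c` gives one of its mixed moments. -/
lemma IsDirichletProcess.lintegral_prod_fiber (hQ : IsDirichletProcess P Q θ G) {N : ℕ}
    {f : X → Fin N} (hf : Measurable f) (c : κ → Fin N) :
    ∫⁻ ω, ∏ k, Q ω (f ⁻¹' {c k}) ∂P =
      dirichletMoment (fun i => θ * G.real (f ⁻¹' {i})) fun i => Fintype.card {k // c k = i} := by
  have hQp := hQ.isProbabilityMeasure
  rw [dirichletMoment, ← hQ.map_partition N (fun i => f ⁻¹' {i}) (fun i => hf (by simp))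
    (fun i l hil => by
      refine Set.disjoint_left.mpr fun y hy hy' => ?_
      exact hil ((Set.mem_singleton_iff.mp hy).symm.trans hy'))
    (by ext y; simp), lintegral_map (by fun_prop)]
  · refine lintegral_congr fun ω => ?_
    simp_rw [ofReal_measureReal (measure_ne_top _ _)]
    rw [← Fintype.prod_fiberwise c]
    refine Finset.prod_congr rfl fun i _ => ?_
    rw [Finset.prod_congr rfl (g := fun _ => Q ω (f ⁻¹' {i})) fun k _ => by rw [k.2]]
    simp
  · exact measurable_pi_iff.mpr fun i =>
      ((Measure.measurable_coe (hf (by simp))).comp hQ.measurable).ennreal_toReal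

lemma IsDirichletProcess.lintegral_mul_prod_fiber [IsProbabilityMeasure G] (hθ : 0 < θ)
    (hQ : IsDirichletProcess P Q θ G) {N : ℕ} {f : X → Fin N} (hf : Measurable f) (b : Fin N)
    (c : κ → Fin N) :
    ∫⁻ ω, Q ω (f ⁻¹' {b}) * ∏ k, Q ω (f ⁻¹' {c k}) ∂P =
      ENNReal.ofReal ((θ * G.real (f ⁻¹' {b}) + Fintype.card {k // c k = b}) /
        (θ + Fintype.card κ)) * ∫⁻ ω, ∏ k, Q ω (f ⁻¹' {c k}) ∂P := by
  classical
  have hsum : ∑ i, G.real (f ⁻¹' {i}) = 1 := by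
    rw [sum_measureReal_preimage_singleton _ fun i _ => hf (by simp)]
    simp
  have hpos : ∃ i, 0 < θ * G.real (f ⁻¹' {i}) := by
    by_contra! h
    have : ∑ i, θ * G.real (f ⁻¹' {i}) ≤ 0 := Finset.sum_nonpos fun i _ => h i
    rw [← Finset.mul_sum, hsum] at this
    linarith
  have hcard : ∑ i, (Fintype.card {k // c k = i} : ℝ) = Fintype.card κ := by
    rw [← Nat.cast_sum, ← Fintype.card_sigma, Fintype.card_congr (Equiv.sigmaFiberEquiv c)]
  -- The further observation is indexed by `none`; it raises the exponent of the cell `b` by one.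
  have h1 := hQ.lintegral_prod_fiber hf fun o : Option κ => o.elim b c
  simp only [Fintype.prod_option, Option.elim_none, Option.elim_some] at h1
  have hm : (fun i => Fintype.card {o : Option κ // o.elim b c = i}) =
      (fun i => Fintype.card {k // c k = i}) + Pi.single b 1 := by
    funext i
    simp only [Fintype.card_subtype, Pi.add_apply, Pi.single_apply, Finset.card_filter,
      Fintype.sum_option, Option.elim_none, Option.elim_some, eq_comm (a := b)]
    rw [add_comm]
    congr!
  rw [h1, hm, dirichletMoment_add_single (fun i => by positivity) hpos,
    hQ.lintegral_prod_fiber hf c, ← Finset.mul_sum, hsum, mul_one, hcard]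

/-- The joint law of a finite sample from a Dirichlet process and of one further observation. -/
lemma IsDirichletProcess.map_pair [IsProbabilityMeasure P] [IsProbabilityMeasure G] (hθ : 0 < θ)
    (hQ : IsDirichletProcess P Q θ G) (hx : IsCondIID P Q x) {a : κ → ι} (ha : a.Injective)
    {i₀ : ι} (hi₀ : ∀ k, a k ≠ i₀) :
    P.map (fun ω => (x i₀ ω, fun k => x (a k) ω)) =
      ENNReal.ofReal (1 / (θ + Fintype.card κ)) •
        (ENNReal.ofReal θ • G.prod (P.map fun ω k => x (a k) ω) +
          ∑ k, (P.map fun ω k => x (a k) ω).map fun y => (y k, y)) := by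
  classical
  have hmeas := hx.measurable_family a
  have hpair : Measurable fun ω => (x i₀ ω, fun k => x (a k) ω) := (hx.1 i₀).prodMk hmeas
  set L := P.map fun ω k => x (a k) ω with hL
  set μ := P.map (fun ω => (x i₀ ω, fun k => x (a k) ω)) with hμ
  set ν := ENNReal.ofReal (1 / (θ + Fintype.card κ)) •
        (ENNReal.ofReal θ • G.prod L + ∑ k, L.map fun y => (y k, y)) with hν
  have hT : 0 < θ + Fintype.card κ := by positivity
  have : IsProbabilityMeasure L := Measure.isProbabilityMeasure_map hmeas.aemeasurable
  have : IsProbabilityMeasure μ := Measure.isProbabilityMeasure_map hpair.aemeasurable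
  have hinj : Function.Injective fun o : Option κ => o.elim i₀ a := by
    rintro (_ | k) (_ | l) h
    · rfl
    · exact absurd h.symm (hi₀ l)
    · exact absurd h (hi₀ k)
    · exact congrArg some (ha h)
  have hLapply : ∀ A : κ → Set X, (∀ k, MeasurableSet (A k)) →
      L (Set.univ.pi A) = ∫⁻ ω, ∏ k, Q ω (A k) ∂P := fun A hA => by
    rw [hL, Measure.map_apply hmeas (MeasurableSet.univ_pi hA), ← hx.measure_cylinder ha hA]
    simp [Set.preimage, Set.mem_pi]
  have hμapply : ∀ (B : Set X) (A : κ → Set X), MeasurableSet B → (∀ k, MeasurableSet (A k)) →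
      μ (B ×ˢ Set.univ.pi A) = ∫⁻ ω, Q ω B * ∏ k, Q ω (A k) ∂P := fun B A hB hA => by
    have h := hx.measure_cylinder hinj (A := fun o : Option κ => o.elim B A)
      (by rintro (_ | k); exacts [hB, hA k])
    simp only [Fintype.prod_option, Option.elim_none, Option.elim_some, Option.forall] at h
    rw [hμ, Measure.map_apply hpair (hB.prod (MeasurableSet.univ_pi hA)), ← h]
    simp [Set.preimage, Set.mem_pi]
  have hνapply : ∀ (B : Set X) (A : Set (κ → X)), MeasurableSet B → MeasurableSet A →
      ν (B ×ˢ A) = ENNReal.ofReal (1 / (θ + Fintype.card κ)) *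
        (ENNReal.ofReal θ * (G B * L A) + ∑ k, L ({y | y k ∈ B} ∩ A)) := fun B A hB hA => by
    simp only [hν, Measure.smul_apply, Measure.add_apply, Measure.finsetSum_apply, smul_eq_mul,
      Measure.prod_prod]
    congr 3
    funext k
    rw [Measure.map_apply (by fun_prop) (hB.prod hA)]
    rfl
  -- After discretisation by a finite-valued `f`, the identity is the moment recursion checked on
  -- singletons.
  have hfin : ∀ (N : ℕ) (f : X → Fin N), Measurable f →
      μ.map (Prod.map f fun y k => f (y k)) = ν.map (Prod.map f fun y k => f (y k)) := by
    intro N f hf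
    have hΦ : Measurable (Prod.map f fun (y : κ → X) k => f (y k)) := by fun_prop
    refine Measure.ext_of_singleton fun ⟨b, c⟩ => ?_
    rw [Measure.map_apply hΦ (by simp), Measure.map_apply hΦ (by simp)]
    have hpre : (Prod.map f fun (y : κ → X) k => f (y k)) ⁻¹' {(b, c)} =
        (f ⁻¹' {b}) ×ˢ Set.univ.pi fun k => f ⁻¹' {c k} := by
      ext ⟨y, h⟩
      simp [Set.mem_pi, funext_iff]
    have hms : ∀ b, MeasurableSet (f ⁻¹' {b}) := fun b => hf (by simp)
    rw [hpre, hμapply _ _ (hms b) (fun k => hms _),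
      hνapply _ _ (hms b) (MeasurableSet.univ_pi fun k => hms _),
      hQ.lintegral_mul_prod_fiber hθ hf, hLapply _ fun k => hms _]
    -- On the cylinder the `k`-th observation lies in cell `c k`, so the term is all or nothing;
    -- summing over `k` counts the observations in cell `b`.
    have hk : ∀ k, L ({y | y k ∈ f ⁻¹' {b}} ∩ Set.univ.pi fun k => f ⁻¹' {c k}) =
        if c k = b then ∫⁻ ω, ∏ k, Q ω (f ⁻¹' {c k}) ∂P else 0 := by
      intro k
      split_ifs with h
      · rw [← hLapply _ fun k => hms _]
        congr 1
        refine Set.inter_eq_right.mpr fun y hy => ?_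
        simpa [h] using hy k (Set.mem_univ k)
      · convert measure_empty (μ := L)
        ext y
        simp only [Set.mem_inter_iff, Set.mem_ofPred_eq, Set.mem_preimage, Set.mem_singleton_iff,
          Set.mem_pi, Set.mem_univ, true_imp_iff, Set.mem_empty_iff_false, iff_false, not_and]
        exact fun h1 h2 => h ((h2 k).symm.trans h1)
    simp_rw [hk]
    rw [Finset.sum_ite, Finset.sum_const, Finset.sum_const_zero, add_zero, nsmul_eq_mul,
      ← Fintype.card_subtype, div_eq_mul_one_div, mul_comm (_ + _) (1 / _),
      ENNReal.ofReal_mul (by positivity), ENNReal.ofReal_add (by positivity) (by positivity),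
      ENNReal.ofReal_mul hθ.le, ENNReal.ofReal_natCast, ofReal_measureReal (measure_ne_top _ _)]
    ring
  have hrect : ∀ (B : Set X) (A : κ → Set X), MeasurableSet B → (∀ k, MeasurableSet (A k)) →
      μ (B ×ˢ Set.univ.pi A) = ν (B ×ˢ Set.univ.pi A) := by
    intro B A hB hA
    -- All sets of the box are unions of fibres of one finite-valued map: the membership pattern of
    -- a point in `B` and in every `A k`.
    let e := Fintype.equivFin (Option κ → Prop)
    let f : X → Fin (Fintype.card (Option κ → Prop)) := fun y => e fun o => y ∈ o.elim B A
    have hf : Measurable f := by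
      refine (measurable_of_finite e).comp (measurable_pi_iff.mpr ?_)
      rintro (_ | k)
      exacts [measurableSet_setOfPred.mp hB, measurableSet_setOfPred.mp (hA k)]
    have hΦ : Measurable (Prod.map f fun (y : κ → X) k => f (y k)) := by fun_prop
    have hpre : B ×ˢ Set.univ.pi A = (Prod.map f fun (y : κ → X) k => f (y k)) ⁻¹'
        {q | e.symm q.1 none ∧ ∀ k, e.symm (q.2 k) (some k)} := by
      ext ⟨y, h⟩
      simp [f, Set.mem_pi]
    rw [hpre, ← Measure.map_apply hΦ (Set.toFinite _).measurableSet, hfin _ f hf,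
      Measure.map_apply hΦ (Set.toFinite _).measurableSet]
  refine Measure.ext_prod fun {B A} hB hA => ?_
  -- For fixed `B`, both sides are finite measures in `A`, so agreement on boxes suffices.
  have hslice : ∀ (ρ : Measure (X × (κ → X))) (A : Set (κ → X)), MeasurableSet A →
      (ρ.restrict (B ×ˢ Set.univ)).map Prod.snd A = ρ (B ×ˢ A) := fun ρ A hA => by
    rw [Measure.map_apply measurable_snd hA, Measure.restrict_apply (measurable_snd hA)]
    congr 1
    ext ⟨y, h⟩
    simp [and_comm]
  rw [← hslice μ A hA, ← hslice ν A hA]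
  congr 1
  refine measure_pi_ext fun A hA => ?_
  rw [hslice _ _ (MeasurableSet.univ_pi hA), hslice _ _ (MeasurableSet.univ_pi hA), hrect B A hB hA]

/-- In the urn scheme of a Dirichlet process with diffuse base measure, a further observation
repeats one of `m` earlier ones with probability `m / (θ + m)`, independently of these. -/
lemma IsDirichletProcess.measure_repeat [StandardBorelSpace X] [IsProbabilityMeasure P]
    [IsProbabilityMeasure G] [NullSingletonClass G] (hθ : 0 < θ)
    (hQ : IsDirichletProcess P Q θ G) (hx : IsCondIID P Q x) {a : κ → ι} (ha : a.Injective)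
    {i₀ : ι} (hi₀ : ∀ k, a k ≠ i₀) {C : Set (κ → X)} (hC : MeasurableSet C) :
    P {ω | (∃ k, x i₀ ω = x (a k) ω) ∧ (fun k => x (a k) ω) ∈ C} =
      ENNReal.ofReal (Fintype.card κ / (θ + Fintype.card κ)) *
        P {ω | (fun k => x (a k) ω) ∈ C} := by
  have hmeas := hx.measurable_family a
  have hpair : Measurable fun ω => (x i₀ ω, fun k => x (a k) ω) := (hx.1 i₀).prodMk hmeas
  set D : Set (X × (κ → X)) := {q | (∃ k, q.1 = q.2 k) ∧ q.2 ∈ C} with hD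
  have hDm : MeasurableSet D := by
    have : D = (⋃ k, {q | q.1 = q.2 k}) ∩ Prod.snd ⁻¹' C := by ext; simp [hD]
    rw [this]
    exact (MeasurableSet.iUnion fun k => measurableSet_eq_fun (by fun_prop) (by fun_prop)).inter
      (measurable_snd hC)
  have hL : (P.map fun ω k => x (a k) ω) C = P {ω | (fun k => x (a k) ω) ∈ C} :=
    Measure.map_apply hmeas hC
  have : IsProbabilityMeasure (P.map fun ω k => x (a k) ω) :=
    Measure.isProbabilityMeasure_map hmeas.aemeasurable
  -- For fixed earlier values, a repetition confines the fresh point to a finite set, which is null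
  -- for the diffuse `G`.
  have h0 : (G.prod (P.map fun ω k => x (a k) ω)) D = 0 := by
    rw [Measure.prod_apply_symm hDm]
    refine (lintegral_congr fun y => ?_).trans lintegral_zero
    refine measure_mono_null (t := Set.range y) ?_ ((Set.finite_range y).measure_zero G)
    rintro z ⟨⟨k, hk⟩, -⟩
    exact ⟨k, hk.symm⟩
  have h1 : ∀ k, ((P.map fun ω k => x (a k) ω).map fun y => (y k, y)) D =
      P {ω | (fun k => x (a k) ω) ∈ C} := fun k => by
    rw [Measure.map_apply (by fun_prop) hDm, ← hL]
    congr 1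
    ext y
    simp only [hD, Set.mem_preimage, Set.mem_ofPred_eq, and_iff_right_iff_imp]
    exact fun _ => ⟨k, rfl⟩
  have h := congrArg (fun ρ => ρ D) (hQ.map_pair hθ hx ha hi₀)
  simp only [Measure.smul_apply, Measure.add_apply, Measure.finsetSum_apply, smul_eq_mul, h0, h1,
    mul_zero, zero_add, Finset.sum_const, Finset.card_univ, nsmul_eq_mul,
    Measure.map_apply hpair hDm] at h
  rw [← mul_assoc, ← ENNReal.ofReal_natCast, ← ENNReal.ofReal_mul (by positivity),
    one_div_mul_eq_div] at h
  exact h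

end Urn

/-! ### Labels in order of appearance -/

lemma orderLabel_congr {ι α β : Type*} [LinearOrder ι] {x : ι → α} {x' : ι → β} {y : α} {y' : β}
    (hx : ∀ a b, x a = x b ↔ x' a = x' b) (hy : ∀ a, x a = y ↔ x' a = y') :
    orderLabel x y = orderLabel x' y' := by
  simp only [orderLabel, ne_eq, hx, hy]

/-- A first occurrence counted for `x i` comes before `i`, hence is also counted for `y`; the index
`i` itself is counted for `y` only. -/
lemma orderLabel_lt_of_first {ι α : Type*} [LinearOrder ι] [Finite ι] {x : ι → α} {i : ι}
    (hi : ∀ b < i, x b ≠ x i) {y : α} (hy : ∀ b ≤ i, x b ≠ y) :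
    orderLabel x (x i) < orderLabel x y := by
  refine Nat.add_lt_add_right (Set.ncard_lt_ncard ⟨?_, ?_⟩ (Set.toFinite _)) 1
  · rintro a ⟨ha, ha'⟩
    refine ⟨ha, fun b hb => hy b ?_⟩
    by_contra! h
    exact ha' i (h.le.trans hb) rfl
  · exact fun h => (h (show i ∈ _ from ⟨hi, hy⟩)).2 i le_rfl rfl

/-- A label in the range of the family determines the value. -/
lemma orderLabel_eq_iff {ι α : Type*} [LinearOrder ι] [Finite ι] {x : ι → α} {y : α} {i : ι} :
    orderLabel x y = orderLabel x (x i) ↔ y = x i := by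
  refine ⟨fun h => ?_, fun h => by rw [h]⟩
  by_contra hne
  obtain ⟨a, hai, ha⟩ := (Set.toFinite {a | x a = x i}).exists_minimal ⟨i, rfl⟩
  have ha' : ∀ b < a, x b ≠ x a := fun b hb hba =>
    not_le.mpr hb (ha (show b ∈ {a | x a = x i} from hba.trans hai) hb.le)
  have hai : x a = x i := hai
  -- Whichever of `y` and `x i` appears first has the strictly smaller label.
  by_cases hy : ∃ b ≤ a, x b = y
  · obtain ⟨b₁, hb₁, hb₁y⟩ := hy
    obtain ⟨b, hby, hb⟩ := (Set.toFinite {b | x b = y}).exists_minimal ⟨b₁, hb₁y⟩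
    have hby : x b = y := hby
    have hbb : b ≤ b₁ := by
      by_contra! hlt
      exact not_le.mpr hlt (hb hb₁y hlt.le)
    have hlt : b < a := lt_of_le_of_ne (hbb.trans hb₁) fun e => hne (by rw [← hby, e, hai])
    have := orderLabel_lt_of_first (x := x) (i := b) (fun c hc hcb =>
      not_le.mpr hc (hb (show c ∈ {b | x b = y} from hcb.trans hby) hc.le)) (y := x i)
      fun c hc hci => ha' c (hc.trans_lt hlt) (hci.trans hai.symm)
    rw [hby] at this
    exact this.ne h
  · push Not at hy
    have := orderLabel_lt_of_first ha' hy
    rw [hai] at this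
    exact this.ne' h

lemma orderLabel_inj {ι α : Type*} [LinearOrder ι] [Finite ι] {x : ι → α} {a b : ι} :
    orderLabel x (x a) = orderLabel x (x b) ↔ x a = x b :=
  orderLabel_eq_iff

/-- A function of a finite family that depends only on its equality pattern is measurable. -/
lemma measurable_of_pattern {ι T γ : Type*} [Finite ι] [MeasurableSpace T] [StandardBorelSpace T]
    [MeasurableSpace γ] {f : (ι → T) → γ}
    (hf : ∀ x y : ι → T, (∀ a b, x a = x b ↔ y a = y b) → f x = f y) : Measurable f := by
  -- There are finitely many equality patterns, and each equality event is measurable because the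
  -- space is standard Borel.
  have hp : Measurable fun (x : ι → T) (a b : ι) => x a = x b :=
    measurable_pi_iff.mpr fun a => measurable_pi_iff.mpr fun b =>
      measurableSet_setOfPred.mp (measurableSet_eq_fun (by fun_prop) (by fun_prop))
  have : Function.FactorsThrough f fun (x : ι → T) (a b : ι) => x a = x b := fun x y h =>
    hf x y fun a b => iff_of_eq (congrFun (congrFun h a) b)
  intro s hs
  have hpre : f ⁻¹' s = (fun (x : ι → T) (a b : ι) => x a = x b) ⁻¹'
      {p | ∃ x ∈ f ⁻¹' s, (fun a b => x a = x b) = p} := by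
    ext x
    refine ⟨fun h => ⟨x, h, rfl⟩, ?_⟩
    rintro ⟨y, hy, hxy⟩
    change f x ∈ s
    rw [← this hxy]
    exact hy
  rw [hpre]
  exact hp (Set.toFinite _).measurableSet

section Allocations

variable {T X : Type*} {n d : ℕ} {layer : Fin n → Fin d}

lemma subgroupAlloc_eq_iff {t : Fin n → T} {u u' : Fin n} (h : layer u = layer u') :
    subgroupAlloc layer t u = subgroupAlloc layer t u' ↔ t u = t u' := by
  have e : subgroupAlloc layer t u' = orderLabel (fun a : {a : Fin n // layer a = layer u} => t a)
      (t u') := by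
    rw [subgroupAlloc, h]
  rw [e]
  exact orderLabel_inj (x := fun a : {a : Fin n // layer a = layer u} => t a) (a := ⟨u, rfl⟩)
    (b := ⟨u', h.symm⟩)

lemma subgroupAlloc_congr {T' : Type*} {t : Fin n → T} {t' : Fin n → T'}
    (h : ∀ a b, t a = t b ↔ t' a = t' b) : subgroupAlloc layer t = subgroupAlloc layer t' := by
  funext u
  exact orderLabel_congr (fun _ _ => h _ _) fun _ => h _ _

lemma groupAlloc_eq_iff {t : Fin n → T} {s : Fin d → ℕ → X} {u u' : Fin n} :
    groupAlloc layer t s u = groupAlloc layer t s u' ↔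
      nodeAttr layer t s u = nodeAttr layer t s u' :=
  orderLabel_inj

/-- Subgroups after the removal of a node, in terms of the auxiliary variables. -/
lemma removeSubgroup_subgroupAlloc {t : Fin n → T} {v : Fin n} (u : {u : Fin n // u ≠ v}) :
    removeSubgroup layer (subgroupAlloc layer t) v u =
      orderLabel (fun u' : {u' : Fin n // u' ≠ v ∧ layer u' = layer u} => t u') (t u) := by
  refine orderLabel_congr (fun a b => subgroupAlloc_eq_iff (a.2.2.trans b.2.2.symm)) fun a => ?_
  exact subgroupAlloc_eq_iff a.2.2

lemma removeSubgroup_eq_iff {w : Fin n → ℕ} {v : Fin n} {u u' : {u : Fin n // u ≠ v}}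
    (h : layer u = layer u') :
    removeSubgroup layer w v u = removeSubgroup layer w v u' ↔ w u = w u' := by
  have e : removeSubgroup layer w v u' =
      orderLabel (fun a : {a : Fin n // a ≠ v ∧ layer a = layer u} => w a) (w u') := by
    rw [removeSubgroup, h]
  rw [e]
  exact orderLabel_inj (x := fun a : {a : Fin n // a ≠ v ∧ layer a = layer u} => w a)
    (a := ⟨u, u.2, rfl⟩) (b := ⟨u', u'.2, h.symm⟩)

lemma relabelGroup_groupAlloc {t : Fin n → T} {s : Fin d → ℕ → X} {v u : Fin n} :
    relabelGroup (groupAlloc layer t s) v u =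
      orderLabel (fun u' : {u' : Fin n // u' ≠ v} => nodeAttr layer t s u')
        (nodeAttr layer t s u) :=
  orderLabel_congr (fun _ _ => groupAlloc_eq_iff) fun _ => groupAlloc_eq_iff

lemma relabelGroup_eq_iff {t : Fin n → T} {s : Fin d → ℕ → X} {v : Fin n}
    {u : {u : Fin n // u ≠ v}} :
    relabelGroup (groupAlloc layer t s) v v = removeGroup (groupAlloc layer t s) v u ↔
      nodeAttr layer t s v = nodeAttr layer t s u := by
  rw [removeGroup, relabelGroup_groupAlloc, relabelGroup_groupAlloc]
  exact orderLabel_eq_iff (x := fun u' : {u' : Fin n // u' ≠ v} => nodeAttr layer t s u') (i := u)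

end Allocations

/-! ### Slots for the sociability profiles of the subgroups -/

section Slots

variable {T X : Type*} {n d : ℕ} {layer : Fin n → Fin d} {v : Fin n}

/-- The subgroups formed by the nodes other than `v`. -/
abbrev Slot (layer : Fin n → Fin d) (wv : {u : Fin n // u ≠ v} → ℕ) : Type :=
  Set.range fun u : {u : Fin n // u ≠ v} => (layer u, wv u)

/-- The subgroup of a node other than `v`. -/
def slot (layer : Fin n → Fin d) (wv : {u : Fin n // u ≠ v} → ℕ) (u : {u : Fin n // u ≠ v}) :
    Slot layer wv :=
  ⟨(layer u, wv u), u, rfl⟩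

lemma slot_surjective (wv : {u : Fin n // u ≠ v} → ℕ) : (slot layer wv).Surjective := by
  rintro ⟨_, u, rfl⟩
  exact ⟨u, rfl⟩

noncomputable instance (wv : {u : Fin n // u ≠ v} → ℕ) : Fintype (Slot layer wv) :=
  Fintype.ofFinite _

lemma card_slot (wv : {u : Fin n // u ≠ v} → ℕ) :
    Fintype.card (Slot layer wv) = numSubgroups layer wv := by
  rw [numSubgroups, Set.ncard, Set.encard, ENat.card_eq_coe_fintype_card, ENat.toNat_natCast]

/-- Removing `v` can change the labels of the remaining subgroups, so the profile of a slot must be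
looked up under its label in `w`. The embedding does this; exchangeability later makes its choice
immaterial. -/
lemma exists_slot_embedding {w : Fin n → ℕ} {wv : {u : Fin n // u ≠ v} → ℕ}
    (h : removeSubgroup layer w v = wv) : ∃ a : Slot layer wv → Fin d × ℕ,
      a.Injective ∧ ∀ u, a (slot layer wv u) = (layer u, w u) := by
  have key : ∀ u u' : {u : Fin n // u ≠ v},
      (layer u, w u) = (layer u', w u') ↔ slot layer wv u = slot layer wv u' := by
    intro u u'
    simp only [slot, Subtype.mk.injEq, Prod.mk.injEq, ← h]
    exact and_congr_right fun hl => (removeSubgroup_eq_iff hl).symm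
  obtain ⟨r, hr⟩ := (slot_surjective (layer := layer) wv).hasRightInverse
  refine ⟨fun k => (layer (r k), w (r k)), fun k k' hk => ?_, fun u => ?_⟩
  · rw [← hr k, ← hr k']
    exact (key _ _).mp hk
  · exact (key _ _).mpr (hr _)

/-- The profiles of the subgroups that lead to the group labels `zv`. -/
def profileSet (layer : Fin n → Fin d) (wv zv : {u : Fin n // u ≠ v} → ℕ) (X : Type*) :
    Set (Slot layer wv → X) :=
  {y | (fun u => orderLabel (fun u' => y (slot layer wv u')) (y (slot layer wv u))) = zv}

lemma measurableSet_profileSet [MeasurableSpace X] [StandardBorelSpace X]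
    (wv zv : {u : Fin n // u ≠ v} → ℕ) : MeasurableSet (profileSet layer wv zv X) := by
  have : Measurable fun (y : Slot layer wv → X) u =>
      orderLabel (fun u' => y (slot layer wv u')) (y (slot layer wv u)) :=
    measurable_of_pattern fun x y h => funext fun u =>
      orderLabel_congr (fun _ _ => h _ _) fun _ => h _ _
  exact this (measurableSet_singleton zv)

lemma removeGroup_eq_iff {t : Fin n → T} {s : Fin d → ℕ → X} {wv zv : {u : Fin n // u ≠ v} → ℕ}
    {a : Slot layer wv → Fin d × ℕ}
    (ha : ∀ u, a (slot layer wv u) = (layer u, subgroupAlloc layer t u)) :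
    removeGroup (groupAlloc layer t s) v = zv ↔
      (fun k => s (a k).1 (a k).2) ∈ profileSet layer wv zv X := by
  have : removeGroup (groupAlloc layer t s) v = fun u => orderLabel
      (fun u' => s (a (slot layer wv u')).1 (a (slot layer wv u')).2)
      (s (a (slot layer wv u)).1 (a (slot layer wv u)).2) := by
    funext u
    rw [removeGroup, relabelGroup_groupAlloc]
    simp only [ha, nodeAttr]
  rw [this]
  exact Iff.rfl

lemma relabelGroup_mem_profiles_iff {t : Fin n → T} {s : Fin d → ℕ → X}
    {wv : {u : Fin n // u ≠ v} → ℕ} {a : Slot layer wv → Fin d × ℕ}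
    (ha : ∀ u, a (slot layer wv u) = (layer u, subgroupAlloc layer t u)) :
    relabelGroup (groupAlloc layer t s) v v ∈ profiles (removeGroup (groupAlloc layer t s) v) ↔
      ∃ k, s (layer v) (subgroupAlloc layer t v) = s (a k).1 (a k).2 := by
  simp only [profiles, Set.mem_range, (slot_surjective wv).exists, ha]
  exact exists_congr fun u => eq_comm.trans relabelGroup_eq_iff

end Slots

/-- Whether the node `v` shares its subgroup with another node. -/
def SharesSubgroup {n d : ℕ} (layer : Fin n → Fin d) (v : Fin n) (w : Fin n → ℕ) : Prop :=
  ∃ u, (u ≠ v ∧ layer u = layer v) ∧ w v = w u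

/-- Nodes of one subgroup carry one profile. The converse fails, since distinct subgroups of a layer
may share a profile. -/
lemma relabelGroup_mem_layerProfiles {T X : Type*} {n d : ℕ} {layer : Fin n → Fin d} {v : Fin n}
    {t : Fin n → T} {s : Fin d → ℕ → X} (h : SharesSubgroup layer v (subgroupAlloc layer t)) :
    relabelGroup (groupAlloc layer t s) v v ∈
      layerProfiles layer (layer v) (removeGroup (groupAlloc layer t s) v) := by
  obtain ⟨u, ⟨huv, hu⟩, hw⟩ := h
  refine ⟨⟨u, huv⟩, hu, (relabelGroup_eq_iff.mpr ?_).symm⟩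
  simp only [nodeAttr, hu, hw]

/-! ### Measurability of the allocations -/

section Measurability

variable {T X : Type*} [MeasurableSpace T] [StandardBorelSpace T] [MeasurableSpace X]
  [StandardBorelSpace X] {n d : ℕ} (layer : Fin n → Fin d)

lemma measurable_subgroupAlloc : Measurable fun t : Fin n → T => subgroupAlloc layer t :=
  measurable_of_pattern fun _ _ h => subgroupAlloc_congr h

lemma measurable_groupAlloc :
    Measurable fun p : (Fin n → T) × (Fin d → ℕ → X) => groupAlloc layer p.1 p.2 := by
  have hl : Measurable fun (y : Fin n → X) u => orderLabel y (y u) :=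
    measurable_of_pattern fun x y h => funext fun u =>
      orderLabel_congr (fun _ _ => h _ _) fun _ => h _ _
  have hw : Measurable fun p : (Fin n → T) × (Fin d → ℕ → X) => subgroupAlloc layer p.1 :=
    (measurable_subgroupAlloc layer).comp measurable_fst
  have ha : Measurable fun p : (Fin n → T) × (Fin d → ℕ → X) => nodeAttr layer p.1 p.2 := by
    refine measurable_pi_iff.mpr fun u A hA => ?_
    have : (fun p : (Fin n → T) × (Fin d → ℕ → X) => nodeAttr layer p.1 p.2 u) ⁻¹' A =
        ⋃ k : ℕ, {p | subgroupAlloc layer p.1 u = k} ∩ {p | p.2 (layer u) k ∈ A} := by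
      ext p
      simp [nodeAttr]
    rw [this]
    refine MeasurableSet.iUnion fun k => MeasurableSet.inter ?_ ?_
    · exact (measurable_pi_iff.mp hw u) (measurableSet_singleton k)
    · exact (show Measurable fun p : (Fin n → T) × (Fin d → ℕ → X) => p.2 (layer u) k by
        fun_prop) hA
  exact hl.comp ha

lemma measurableSet_alloc (R : (Fin n → ℕ) → (Fin n → ℕ) → Prop) :
    MeasurableSet {p : (Fin n → T) × (Fin d → ℕ → X) |
      R (groupAlloc layer p.1 p.2) (subgroupAlloc layer p.1)} :=
  ((measurable_groupAlloc layer).prodMk ((measurable_subgroupAlloc layer).comp measurable_fst))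
    (Set.to_countable {q : (Fin n → ℕ) × (Fin n → ℕ) | R q.1 q.2}).measurableSet

end Measurability

/-! ### Conditional behaviour of one node in the hierarchical scheme -/

section Scheme

variable {Ω T X : Type*} [MeasurableSpace Ω] {P : Measure Ω} [MeasurableSpace T]
  [MeasurableSpace X] {n d : ℕ} {layer : Fin n → Fin d} {θ θ₀ : ℝ} {G : Fin d → Measure T} {P₀ : Measure X}
  {Q : Fin d → Ω → Measure T} {t : Fin n → Ω → T} {R : Ω → Measure X} {s : Fin d → ℕ → Ω → X}

lemma IsHDPScheme.measurable_t (h : IsHDPScheme P layer θ θ₀ G P₀ Q t R s) :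
    Measurable fun ω u => t u ω :=
  measurable_pi_iff.mpr fun u => (h.sample_layer (layer u)).1 ⟨u, rfl⟩

lemma IsHDPScheme.measurable_s (h : IsHDPScheme P layer θ θ₀ G P₀ Q t R s) :
    Measurable fun ω j τ => s j τ ω :=
  measurable_pi_iff.mpr fun j => measurable_pi_iff.mpr fun τ => h.sample_root.1 (j, τ)

variable [IsProbabilityMeasure P]

/-- The probability that `v` joins one of the subgroups formed by the other nodes. -/
lemma IsHDPScheme.measure_sharesSubgroup [StandardBorelSpace T]
    [∀ j, IsProbabilityMeasure (G j)] [∀ j, NullSingletonClass (G j)] (hθ : 0 < θ) (h : IsHDPScheme P layer θ θ₀ G P₀ Q t R s)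
    (v : Fin n) (wv : {u : Fin n // u ≠ v} → ℕ) :
    P {ω | removeSubgroup layer (subgroupAlloc layer fun u => t u ω) v = wv ∧
        SharesSubgroup layer v (subgroupAlloc layer fun u => t u ω)} =
      ENNReal.ofReal (((layerSize layer (layer v) : ℝ) - 1) /
        (θ + ((layerSize layer (layer v) : ℝ) - 1))) *
        P {ω | removeSubgroup layer (subgroupAlloc layer fun u => t u ω) v = wv} := by
  classical
  let κ : Fin d → Type := fun j => {u : Fin n // u ≠ v ∧ layer u = j}
  let C : ∀ j, Set (κ j → T) := fun j =>
    {y | (fun u => orderLabel y (y u)) = fun u : κ j => wv ⟨u.1, u.2.1⟩}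
  have hC : ∀ j, MeasurableSet (C j) := fun j => by
    have : Measurable fun (y : κ j → T) u => orderLabel y (y u) :=
      measurable_of_pattern fun x y h => funext fun u =>
        orderLabel_congr (fun _ _ => h _ _) fun _ => h _ _
    exact this (measurableSet_singleton _)
  let ρ : ∀ j, ({u : Fin n // layer u = j} → T) → κ j → T := fun j y k => y ⟨k.1, k.2.2⟩
  have hρ : ∀ j, Measurable (ρ j) := fun j => by fun_prop
  let S : ∀ j, Set ({u : Fin n // layer u = j} → T) := fun j => ρ j ⁻¹' C j
  have hS : ∀ j, MeasurableSet (S j) := fun j => hρ j (hC j)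
  let D : Set ({u : Fin n // layer u = layer v} → T) :=
    {y | ∃ k : κ (layer v), y ⟨v, rfl⟩ = y ⟨k.1, k.2.2⟩}
  have hDm : MeasurableSet D := by
    have : D = ⋃ k : κ (layer v), {y | y ⟨v, rfl⟩ = y ⟨k.1, k.2.2⟩} := by
      ext; simp [D]
    rw [this]
    exact MeasurableSet.iUnion fun k => measurableSet_eq_fun (by fun_prop) (by fun_prop)
  let ξ : ∀ j, Ω → {u : Fin n // layer u = j} → T := fun j ω u => t u ω
  have hind : iIndepFun ξ P := h.indep_layers.comp (fun _ => Prod.snd) fun _ => measurable_snd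
  have hW : {ω | removeSubgroup layer (subgroupAlloc layer fun u => t u ω) v = wv} =
      ⋂ j ∈ Finset.univ, ξ j ⁻¹' S j := by
    ext ω
    simp only [Set.mem_ofPred_eq, Set.mem_iInter, Finset.mem_univ, true_imp_iff, funext_iff,
      removeSubgroup_subgroupAlloc]
    refine ⟨fun hw j => ?_, fun hw u => ?_⟩
    · refine funext fun u => ?_
      obtain ⟨u, hu, rfl⟩ := u
      exact hw ⟨u, hu⟩
    · exact congrFun (hw (layer u)) ⟨u.1, u.2, rfl⟩
  -- Layers are independent, so the other layers contribute the same factor whatever is asked of the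
  -- layer of `v`.
  have hB : ∀ B : Set ({u : Fin n // layer u = layer v} → T), MeasurableSet B →
      P (ξ (layer v) ⁻¹' B ∩ ⋂ j ∈ Finset.univ.erase (layer v), ξ j ⁻¹' S j) =
      P (ξ (layer v) ⁻¹' B) * ∏ j ∈ Finset.univ.erase (layer v), P (ξ j ⁻¹' S j) := by
    intro B hBm
    have := hind.measure_inter_preimage_eq_mul Finset.univ (sets := Function.update S (layer v) B)
      fun j _ => by
        rcases eq_or_ne j (layer v) with rfl | hj
        · simpa using hBm
        · simpa [hj] using hS j
    rw [← Finset.insert_erase (Finset.mem_univ (layer v)), Finset.set_biInter_insert,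
      Finset.prod_insert (Finset.notMem_erase _ _), Function.update_self] at this
    convert this using 3
    · refine Set.iInter₂_congr fun j hj => ?_
      rw [Function.update_of_ne (Finset.ne_of_mem_erase hj)]
    · rename_i j hj
      rw [Function.update_of_ne (Finset.ne_of_mem_erase hj)]
  have hWB : ⋂ j ∈ Finset.univ, ξ j ⁻¹' S j = ξ (layer v) ⁻¹' S (layer v) ∩
      ⋂ j ∈ Finset.univ.erase (layer v), ξ j ⁻¹' S j := by
    rw [← Finset.set_biInter_insert (layer v) _ fun j => ξ j ⁻¹' S j,
      Finset.insert_erase (Finset.mem_univ _)]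
  have hWD : {ω | removeSubgroup layer (subgroupAlloc layer fun u => t u ω) v = wv ∧
        SharesSubgroup layer v (subgroupAlloc layer fun u => t u ω)} =
      ξ (layer v) ⁻¹' (S (layer v) ∩ D) ∩
        ⋂ j ∈ Finset.univ.erase (layer v), ξ j ⁻¹' S j := by
    have : {ω | SharesSubgroup layer v (subgroupAlloc layer fun u => t u ω)} =
        ξ (layer v) ⁻¹' D := by
      ext ω
      simp only [SharesSubgroup, Set.mem_ofPred_eq]
      refine ⟨fun ⟨u, hu, hw⟩ => ⟨⟨u, hu⟩, (subgroupAlloc_eq_iff hu.2.symm).mp hw⟩,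
        fun ⟨u, hu⟩ => ⟨u.1, u.2, (subgroupAlloc_eq_iff u.2.2.symm).mpr hu⟩⟩
    rw [Set.ofPred_and, hW, this, hWB, Set.preimage_inter, Set.inter_right_comm]
  -- The `-1` accounts for `v` itself.
  have hcard : (Fintype.card (κ (layer v)) : ℝ) = (layerSize layer (layer v) : ℝ) - 1 := by
    have h1 : Finset.univ.filter (fun u => layer u = layer v) =
        insert v (Finset.univ.filter fun u => u ≠ v ∧ layer u = layer v) := by
      ext u
      by_cases hu : u = v <;> simp [hu]
    rw [layerSize, h1, Finset.card_insert_of_notMem (by simp), Fintype.card_subtype]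
    simp
  have hrep := (h.dirichlet_layer (layer v)).measure_repeat hθ (h.sample_layer (layer v))
    (a := fun k : κ (layer v) => ⟨k.1, k.2.2⟩) (i₀ := ⟨v, rfl⟩)
    (fun k l hkl => Subtype.ext (congrArg (fun x => x.1) hkl))
    (fun k hk => k.2.1 (congrArg (fun x => x.1) hk)) (hC (layer v))
  rw [hcard] at hrep
  rw [hWD, hB _ ((hS _).inter hDm), hW, hWB, hB _ (hS _), ← mul_assoc]
  congr 1
  refine Eq.trans (congrArg P ?_) hrep
  ext ω
  exact and_comm

variable [StandardBorelSpace X]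

/-- The probability that the profiles lead to the group labels `zv`. -/
lemma IsHDPScheme.measure_removeGroup (h : IsHDPScheme P layer θ θ₀ G P₀ Q t R s) {v : Fin n}
    {wv zv : {u : Fin n // u ≠ v} → ℕ} {τ : Fin n → T}
    (hτ : removeSubgroup layer (subgroupAlloc layer τ) v = wv) :
    P {ω | removeGroup (groupAlloc layer τ fun j k => s j k ω) v = zv} =
      P.map (fun ω (k : Slot layer wv) => s k.1.1 k.1.2 ω) (profileSet layer wv zv X) := by
  obtain ⟨a, ha, ha'⟩ := exists_slot_embedding hτ
  -- Exchangeability replaces the embedding, which depends on `τ`, by the inclusion of the slots,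
  -- which depends on `wv` only.
  have hmap := h.sample_root.map_eq_map ha (Subtype.val_injective (p := (· ∈ Set.range
    fun u : {u : Fin n // u ≠ v} => (layer u, wv u))))
  rw [← hmap, Measure.map_apply (h.sample_root.measurable_family a)
    (measurableSet_profileSet wv zv)]
  simp only [removeGroup_eq_iff ha']
  rfl

/-- The probability that a new subgroup takes a profile that is already present. -/
lemma IsHDPScheme.measure_removeGroup_profiles [IsProbabilityMeasure P₀] [NullSingletonClass P₀]
    (hθ₀ : 0 < θ₀) (h : IsHDPScheme P layer θ θ₀ G P₀ Q t R s) {v : Fin n}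
    {wv zv : {u : Fin n // u ≠ v} → ℕ} {τ : Fin n → T}
    (hτ : removeSubgroup layer (subgroupAlloc layer τ) v = wv)
    (hnew : ¬ SharesSubgroup layer v (subgroupAlloc layer τ)) :
    P {ω | removeGroup (groupAlloc layer τ fun j k => s j k ω) v = zv ∧
        relabelGroup (groupAlloc layer τ fun j k => s j k ω) v v ∈ profiles zv} =
      ENNReal.ofReal (numSubgroups layer wv / (θ₀ + numSubgroups layer wv)) *
        P.map (fun ω (k : Slot layer wv) => s k.1.1 k.1.2 ω) (profileSet layer wv zv X) := by
  rw [← h.measure_removeGroup hτ]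
  obtain ⟨a, ha, ha'⟩ := exists_slot_embedding hτ
  -- A subgroup containing `v` alone occupies no slot, so its profile is a genuinely further draw.
  have hi₀ : ∀ k, a k ≠ (layer v, subgroupAlloc layer τ v) := by
    intro k hk
    obtain ⟨u, rfl⟩ := slot_surjective wv k
    rw [ha', Prod.mk.injEq] at hk
    exact hnew ⟨u, ⟨u.2, hk.1⟩, hk.2.symm⟩
  have hrep := h.dirichlet_root.measure_repeat hθ₀ h.sample_root ha hi₀
    (measurableSet_profileSet wv zv)
  rw [card_slot] at hrep
  have e1 : {ω | removeGroup (groupAlloc layer τ fun j k => s j k ω) v = zv ∧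
        relabelGroup (groupAlloc layer τ fun j k => s j k ω) v v ∈ profiles zv} =
      {ω | (∃ k, s (layer v) (subgroupAlloc layer τ v) ω = s (a k).1 (a k).2 ω) ∧
        (fun k => s (a k).1 (a k).2 ω) ∈ profileSet layer wv zv X} := by
    ext ω
    simp only [Set.mem_ofPred_eq]
    rw [and_comm, ← removeGroup_eq_iff (s := fun j k => s j k ω) ha']
    refine and_congr_left fun hz => ?_
    rw [← hz]
    exact relabelGroup_mem_profiles_iff ha'
  rw [e1, hrep]
  simp only [removeGroup_eq_iff ha']

variable [StandardBorelSpace T]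

/-- Integrating out the sociability profiles given the auxiliary variables of the nodes. -/
lemma IsHDPScheme.measure_alloc (h : IsHDPScheme P layer θ θ₀ G P₀ Q t R s)
    {A : (Fin n → ℕ) → (Fin n → ℕ) → Prop} {D : (Fin n → ℕ) → Prop} {c : ℝ≥0∞}
    (hD : ∀ τ : Fin n → T, D (subgroupAlloc layer τ) →
      P {ω | A (groupAlloc layer τ fun j k => s j k ω) (subgroupAlloc layer τ)} = c)
    (hD' : ∀ τ : Fin n → T, ¬ D (subgroupAlloc layer τ) →
      ∀ z, ¬ A z (subgroupAlloc layer τ)) :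
    P {ω | A (groupAlloc layer (fun u => t u ω) fun j k => s j k ω)
      (subgroupAlloc layer fun u => t u ω)} =
      c * P {ω | D (subgroupAlloc layer fun u => t u ω)} := by
  have hind : IndepFun (fun ω u => t u ω) (fun ω j τ => s j τ ω) P :=
    h.indep_root.comp (φ := Prod.snd) (ψ := Prod.snd) measurable_snd measurable_snd
  have hprod := (indepFun_iff_map_prod_eq_prod_map_map h.measurable_t.aemeasurable
    h.measurable_s.aemeasurable).mp hind
  have hA := measurableSet_alloc (T := T) (X := X) layer A
  have hDm : MeasurableSet {τ : Fin n → T | D (subgroupAlloc layer τ)} :=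
    measurable_subgroupAlloc layer (Set.to_countable {w | D w}).measurableSet
  have : IsProbabilityMeasure (P.map fun ω j τ => s j τ ω) :=
    Measure.isProbabilityMeasure_map h.measurable_s.aemeasurable
  calc _ = (P.map fun ω => (fun u => t u ω, fun j τ => s j τ ω)) {p |
        A (groupAlloc layer p.1 p.2) (subgroupAlloc layer p.1)} := by
        rw [Measure.map_apply (h.measurable_t.prodMk h.measurable_s) hA]
        rfl
    -- By independence the joint law is a product; its section at `τ` has mass `c` on `D` and is
    -- empty off `D`.
    _ = ∫⁻ τ, {τ | D (subgroupAlloc layer τ)}.indicator (fun _ => c) τ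
          ∂P.map fun ω u => t u ω := by
        rw [hprod, Measure.prod_apply hA]
        refine lintegral_congr fun τ => ?_
        rw [Measure.map_apply h.measurable_s (measurable_prodMk_left hA)]
        by_cases hτ : D (subgroupAlloc layer τ)
        · rw [Set.indicator_of_mem (show τ ∈ {τ | D (subgroupAlloc layer τ)} from hτ), ← hD τ hτ]
          rfl
        · rw [Set.indicator_of_notMem (show τ ∉ {τ | D (subgroupAlloc layer τ)} from hτ)]
          convert measure_empty (μ := P)
          ext ω
          exact iff_of_false (hD' τ hτ _) (by simp)
    _ = _ := by
        rw [lintegral_indicator_const hDm, Measure.map_apply h.measurable_t hDm]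
        rfl

/-- Joining a subgroup of the other nodes, jointly with `z⁻ᵛ` and `w⁻ᵛ`. -/
lemma IsHDPScheme.measure_shares [∀ j, IsProbabilityMeasure (G j)]
    [∀ j, NullSingletonClass (G j)] (hθ : 0 < θ) (h : IsHDPScheme P layer θ θ₀ G P₀ Q t R s)
    (v : Fin n) (zv wv : {u : Fin n // u ≠ v} → ℕ) :
    P {ω | (removeGroup (groupAlloc layer (fun u => t u ω) fun j k => s j k ω) v = zv ∧
          removeSubgroup layer (subgroupAlloc layer fun u => t u ω) v = wv) ∧
        SharesSubgroup layer v (subgroupAlloc layer fun u => t u ω)} =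
      ENNReal.ofReal (((layerSize layer (layer v) : ℝ) - 1) /
        (θ + ((layerSize layer (layer v) : ℝ) - 1))) *
      P {ω | removeGroup (groupAlloc layer (fun u => t u ω) fun j k => s j k ω) v = zv ∧
          removeSubgroup layer (subgroupAlloc layer fun u => t u ω) v = wv} := by
  -- Both sides carry the same factor, the probability that the profiles produce `zv`, leaving an
  -- identity about subgroups alone.
  rw [h.measure_alloc (A := fun z w => (removeGroup z v = zv ∧ removeSubgroup layer w v = wv) ∧
      SharesSubgroup layer v w)
      (D := fun w => removeSubgroup layer w v = wv ∧ SharesSubgroup layer v w)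
      (fun τ hτ => by simpa [hτ.1, hτ.2] using h.measure_removeGroup (zv := zv) hτ.1)
      (fun τ hτ z hz => hτ ⟨hz.1.2, hz.2⟩),
    h.measure_alloc (A := fun z w => removeGroup z v = zv ∧ removeSubgroup layer w v = wv)
      (D := fun w => removeSubgroup layer w v = wv)
      (fun τ hτ => by simpa [hτ] using h.measure_removeGroup (zv := zv) hτ)
      (fun τ hτ z hz => hτ hz.2), h.measure_sharesSubgroup hθ]
  ring

/-- Founding a subgroup whose profile is already present, jointly with `z⁻ᵛ` and `w⁻ᵛ`. -/
lemma IsHDPScheme.measure_new_profiles [IsProbabilityMeasure P₀] [NullSingletonClass P₀]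
    (hθ₀ : 0 < θ₀) (h : IsHDPScheme P layer θ θ₀ G P₀ Q t R s)
    (v : Fin n) (zv wv : {u : Fin n // u ≠ v} → ℕ) :
    P {ω | ((removeGroup (groupAlloc layer (fun u => t u ω) fun j k => s j k ω) v = zv ∧
          removeSubgroup layer (subgroupAlloc layer fun u => t u ω) v = wv) ∧
        ¬ SharesSubgroup layer v (subgroupAlloc layer fun u => t u ω)) ∧
        relabelGroup (groupAlloc layer (fun u => t u ω) fun j k => s j k ω) v v ∈ profiles zv} =
      ENNReal.ofReal (numSubgroups layer wv / (θ₀ + numSubgroups layer wv)) *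
      P {ω | (removeGroup (groupAlloc layer (fun u => t u ω) fun j k => s j k ω) v = zv ∧
          removeSubgroup layer (subgroupAlloc layer fun u => t u ω) v = wv) ∧
        ¬ SharesSubgroup layer v (subgroupAlloc layer fun u => t u ω)} := by
  rw [h.measure_alloc (A := fun z w => ((removeGroup z v = zv ∧ removeSubgroup layer w v = wv) ∧
      ¬ SharesSubgroup layer v w) ∧ relabelGroup z v v ∈ profiles zv)
      (D := fun w => removeSubgroup layer w v = wv ∧ ¬ SharesSubgroup layer v w)
      (fun τ hτ => by
        simpa [hτ.1, hτ.2] using h.measure_removeGroup_profiles hθ₀ (zv := zv) hτ.1 hτ.2)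
      (fun τ hτ z hz => hτ ⟨hz.1.1.2, hz.1.2⟩),
    h.measure_alloc (A := fun z w => (removeGroup z v = zv ∧ removeSubgroup layer w v = wv) ∧
      ¬ SharesSubgroup layer v w)
      (D := fun w => removeSubgroup layer w v = wv ∧ ¬ SharesSubgroup layer v w)
      (fun τ hτ => by simpa [hτ.1, hτ.2] using h.measure_removeGroup (zv := zv) hτ.1)
      (fun τ hτ z hz => hτ ⟨hz.1.2, hz.2⟩)]
  ring

end Scheme

end PExP

theorem proposition2
    {Ω T X : Type*} [MeasurableSpace Ω] (P : Measure Ω) [IsProbabilityMeasure P]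
    [MeasurableSpace T] [StandardBorelSpace T] [MeasurableSpace X] [StandardBorelSpace X]
    {n d : ℕ} (layer : Fin n → Fin d) (θ θ₀ : ℝ) (hθ : 0 < θ) (hθ₀ : 0 < θ₀)
    (G : Fin d → Measure T) [∀ j, IsProbabilityMeasure (G j)] [∀ j, NullSingletonClass (G j)]
    (P₀ : Measure X) [IsProbabilityMeasure P₀] [NullSingletonClass P₀]
    (Q : Fin d → Ω → Measure T) (t : Fin n → Ω → T)
    (R : Ω → Measure X) (s : Fin d → ℕ → Ω → X)
    (hscheme : PExP.IsHDPScheme P layer θ θ₀ G P₀ Q t R s)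
    (w z : Ω → Fin n → ℕ)
    (hw : ∀ ω, w ω = PExP.subgroupAlloc layer (fun u => t u ω))
    (hz : ∀ ω, z ω = PExP.groupAlloc layer (fun u => t u ω) (fun j τ => s j τ ω))
    (j : Fin d) (v : Fin n) (hv : layer v = j)
    (zv wv : {u : Fin n // u ≠ v} → ℕ)
    (hpos : P {ω | PExP.removeGroup (z ω) v = zv ∧ PExP.removeSubgroup layer (w ω) v = wv} ≠ 0) :
    (θ ≤ ((PExP.layerSize layer j : ℝ) - 1) * (θ₀ / (PExP.numSubgroups layer wv : ℝ) + 1) →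
      P[{ω | PExP.relabelGroup (z ω) v v ∈ PExP.profiles zv \ PExP.layerProfiles layer j zv} |
          {ω | PExP.removeGroup (z ω) v = zv ∧ PExP.removeSubgroup layer (w ω) v = wv}] ≤
      P[{ω | PExP.relabelGroup (z ω) v v ∈ PExP.layerProfiles layer j zv} |
          {ω | PExP.removeGroup (z ω) v = zv ∧ PExP.removeSubgroup layer (w ω) v = wv}]) ∧
    (θ ≤ (PExP.layerSize layer j : ℝ) - 1 →
      P[{ω | PExP.relabelGroup (z ω) v v ∉ PExP.layerProfiles layer j zv} |
          {ω | PExP.removeGroup (z ω) v = zv ∧ PExP.removeSubgroup layer (w ω) v = wv}] ≤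
      P[{ω | PExP.relabelGroup (z ω) v v ∈ PExP.layerProfiles layer j zv} |
          {ω | PExP.removeGroup (z ω) v = zv ∧ PExP.removeSubgroup layer (w ω) v = wv}]) := by
  subst hv
  obtain rfl : w = fun ω => PExP.subgroupAlloc layer (fun u => t u ω) := funext hw
  obtain rfl : z = fun ω => PExP.groupAlloc layer (fun u => t u ω) (fun j τ => s j τ ω) :=
    funext hz
  set E : Set Ω := {ω | PExP.removeGroup
    (PExP.groupAlloc layer (fun u => t u ω) fun j τ => s j τ ω) v = zv ∧
    PExP.removeSubgroup layer (PExP.subgroupAlloc layer fun u => t u ω) v = wv} with hE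
  set O : Set Ω := {ω | PExP.SharesSubgroup layer v (PExP.subgroupAlloc layer fun u => t u ω)}
    with hO
  set F : Set Ω := {ω | PExP.relabelGroup
    (PExP.groupAlloc layer (fun u => t u ω) fun j τ => s j τ ω) v v ∈ PExP.profiles zv} with hF
  set m : ℝ := (PExP.layerSize layer (layer v) : ℝ) - 1 with hm
  set l : ℝ := (PExP.numSubgroups layer wv : ℝ) with hl
  have hpair : Measurable fun ω => ((fun u => t u ω), (fun j τ => s j τ ω)) :=
    hscheme.measurable_t.prodMk hscheme.measurable_s
  have hEm : MeasurableSet E := hpair (PExP.measurableSet_alloc layer fun z w =>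
    PExP.removeGroup z v = zv ∧ PExP.removeSubgroup layer w v = wv)
  have hOm : MeasurableSet O := hpair (PExP.measurableSet_alloc layer fun _ w =>
    PExP.SharesSubgroup layer v w)
  have hm0 : 0 ≤ m := by
    have : 1 ≤ PExP.layerSize layer (layer v) := Finset.card_pos.mpr ⟨v, by simp⟩
    have : (1 : ℝ) ≤ PExP.layerSize layer (layer v) := by exact_mod_cast this
    linarith
  have hl0 : 0 ≤ l := Nat.cast_nonneg _
  have hT : 0 < θ + m := by linarith
  have hold : P.real (E ∩ O) = m / (θ + m) * P.real E := by
    have := congrArg ENNReal.toReal (hscheme.measure_shares hθ v zv wv)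
    rwa [ENNReal.toReal_mul, ENNReal.toReal_ofReal (by positivity)] at this
  have hnew : P.real (E \ O ∩ F) = l / (θ₀ + l) * P.real (E \ O) := by
    have := congrArg ENNReal.toReal (hscheme.measure_new_profiles hθ₀ v zv wv)
    rwa [ENNReal.toReal_mul, ENNReal.toReal_ofReal (by positivity)] at this
  have hdiff : P.real (E \ O) = θ / (θ + m) * P.real E := by
    have h1 := measureReal_inter_add_sdiff (μ := P) (s := E) hOm
    have h2 : m / (θ + m) + θ / (θ + m) = 1 := by field_simp; ring
    rw [hold] at h1
    linear_combination h1 - P.real E * h2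
  have hsub : E ∩ O ⊆ E ∩ {ω | PExP.relabelGroup
      (PExP.groupAlloc layer (fun u => t u ω) fun j τ => s j τ ω) v v ∈
      PExP.layerProfiles layer (layer v) zv} := by
    rintro ω ⟨hω, hωO⟩
    refine ⟨hω, ?_⟩
    have := PExP.relabelGroup_mem_layerProfiles (s := fun j τ => s j τ ω) hωO
    rwa [hω.1] at this
  have hcond : ∀ {A B : Set Ω}, P.real (E ∩ A) ≤ P.real (E ∩ B) → P[A | E] ≤ P[B | E] := by
    intro A B hAB
    rw [cond_apply hEm, cond_apply hEm]
    refine mul_le_mul_right ?_ _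
    exact (ENNReal.toReal_le_toReal (measure_ne_top _ _) (measure_ne_top _ _)).mp hAB
  have hE0 : 0 ≤ P.real E := measureReal_nonneg
  have hlow := measureReal_mono hsub (measure_ne_top P _)
  rw [hold] at hlow
  refine ⟨fun hle => hcond (le_trans ?_ hlow), fun hle => hcond (le_trans ?_ hlow)⟩
  · refine (measureReal_mono (s₂ := E \ O ∩ F) ?_ (measure_ne_top P _)).trans ?_
    · rintro ω ⟨hω, hω1, hω2⟩
      -- A profile outside `H_j⁻ᵛ` excludes sharing a subgroup, so `v` has founded one.
      exact ⟨⟨hω, fun hωO => hω2 (hsub ⟨hω, hωO⟩).2⟩, hω1⟩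
    · rw [hnew, hdiff, ← mul_assoc]
      refine mul_le_mul_of_nonneg_right ?_ hE0
      have hr : l / (θ₀ + l) * θ ≤ m := by
        -- For `l = 0` the left side vanishes and `0 ≤ m` suffices, whatever the value of `θ₀ / 0`.
        rcases hl0.eq_or_lt with h0 | h0
        · simpa [← h0] using hm0
        · calc l / (θ₀ + l) * θ ≤ l / (θ₀ + l) * (m * (θ₀ / l + 1)) := by gcongr
            _ = m := by field_simp
      rw [mul_div_assoc']
      gcongr
  · refine (measureReal_mono (s₂ := E \ O) ?_ (measure_ne_top P _)).trans ?_
    · rintro ω ⟨hω, hω2⟩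
      exact ⟨hω, fun hωO => hω2 (hsub ⟨hω, hωO⟩).2⟩
    · rw [hdiff]
      gcongr
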